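/- Let $N\ge 2$ and let $a=(a_1,\dots,a_N)$ be positive integers with $\gcd(a_1,\dots,a_N)=1$. A representation of a positive integer $t$ in terms of $a$ is a tuple $(x_1,\dots,x_N)$ of nonnegative integers with $t=a_1x_1+\dots+a_Nx_N$. For an integer $s\ge 0$ let the $s$-Frobenius number $g_s(a)$ be the largest positive integer that has precisely $s$ distinct representations in terms of $a$; assume that some positive integer has precisely $s$ representations, so that $g_s(a)$ is defined. Let $\Lambda_a=\{x\in\mathbb Z^N: a_1x_1+\dots+a_Nx_N=0\}$, let $V_a=\operatorname{span}_{\mathbb R}\Lambda_a$, and let $$R_a=\inf\{R>0:\ \Lambda_a+\mathbb B_{V_a}(R)=V_a\}$$ be the covering radius of $\Lambda_a$, where $\mathbb B_{V_a}(R)$ is the closed Euclidean ball of radius $R$ centered at the origin in $V_a$. Let $\tau_m$ be the kissing number in dimension $m$, i.e. the maximal number of unit balls in $\mathbb R^m$ with pairwise disjoint interiors that touch, without overlapping it, another unit ball. Let $\alpha_i=(a_1,\dots,a_{i-1},a_{i+1},\dots,a_N)$ and let $\|\cdot\|$ be the Euclidean norm. 1. If $N\ge 3$, then $$g_s(a)\le\max\left\{\frac{R_a\,(N-1)\sum_{i=1}^N\|\alpha_i\|a_i}{\|a\|}+1,\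 \Big(s\,(N-1)!\prod_{i=1}^N a_i\Big)^{\frac1{N-2}}\right\}.$$ 2. If $s\le\tau_{N-1}+1$ and $(N,s)\ne(2,3)$, then $$g_s(a)\le\frac{3R_a\sum_{i=1}^N\|\alpha_i\|a_i}{\|a\|}.$$ -/

import Mathlib

open scoped Pointwise

noncomputable section

namespace FrobeniusBound

/-- The representations of `t` in terms of `a`: nonnegative integer solutions of
`a₁ x₁ + ⋯ + a_N x_N = t`. -/
def representations {N : ℕ} (a : Fin N → ℕ) (t : ℕ) : Set (Fin N → ℕ) :=
  {x | ∑ i, a i * x i = t}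

/-- `g` is the `s`-Frobenius number of `a`: the largest positive integer that has precisely `s`
distinct representations in terms of `a`. -/
def IsSFrobeniusNumber {N : ℕ} (a : Fin N → ℕ) (s g : ℕ) : Prop :=
  IsGreatest {t : ℕ | 0 < t ∧ (representations a t).encard = (s : ℕ∞)} g

/-- The lattice `Λ_a = {x ∈ ℤ^N : a₁ x₁ + ⋯ + a_N x_N = 0}`, as a subset of Euclidean space. -/
def lattice {N : ℕ} (a : Fin N → ℕ) : Set (EuclideanSpace ℝ (Fin N)) :=
  {x | (∀ i, ∃ z : ℤ, x i = (z : ℝ)) ∧ ∑ i, (a i : ℝ) * x i = 0}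

/-- The real vector space `V_a` spanned by `Λ_a`. -/
def latticeSpan {N : ℕ} (a : Fin N → ℕ) : Submodule ℝ (EuclideanSpace ℝ (Fin N)) :=
  Submodule.span ℝ (lattice a)

/-- The covering radius `R_a` of `Λ_a` in `V_a`: the infimum of all `R > 0` such that `Λ_a` plus
the closed ball of radius `R` around the origin in `V_a` is the whole of `V_a`. -/
def coveringRadius {N : ℕ} (a : Fin N → ℕ) : ℝ :=
  sInf {R : ℝ | 0 < R ∧
    lattice a + (Metric.closedBall 0 R ∩ (latticeSpan a : Set (EuclideanSpace ℝ (Fin N)))) =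
      (latticeSpan a : Set (EuclideanSpace ℝ (Fin N)))}

/-- The kissing number `τ_m`: the maximal number of unit balls in `ℝ^m` with pairwise disjoint
interiors that touch the unit ball centred at the origin. Such balls are given by their centres,
which have norm `2` and pairwise distances at least `2`. -/
def kissingNumber (m : ℕ) : ℕ∞ :=
  ⨆ (S : Set (EuclideanSpace ℝ (Fin m)))
    (_ : (∀ x ∈ S, ‖x‖ = 2) ∧ S.Pairwise fun x y => 2 ≤ dist x y), S.encard

/-- The Euclidean norm `‖a‖`. -/
def vecNorm {N : ℕ} (a : Fin N → ℕ) : ℝ :=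
  ‖(WithLp.toLp 2 fun j => (a j : ℝ) : EuclideanSpace ℝ (Fin N))‖

/-- The Euclidean norm `‖α_i‖`, where `α_i` is `a` with its `i`-th entry removed. -/
def omitNorm {N : ℕ} (a : Fin N → ℕ) (i : Fin N) : ℝ :=
  ‖(WithLp.toLp 2 fun j => (a j.1 : ℝ) : EuclideanSpace ℝ {j : Fin N // j ≠ i})‖

end FrobeniusBound

end

/-! Both bounds are contrapositive: every `t` above the bound has more than `s` representations.
Representations of `t` are the integer points of the simplex a·x = t, x ≥ 0, and these form a
translate of Λ_a cut off by the facets. On V_a the `i`-th coordinate is a functional of norm w_i =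
‖α_i‖/‖a‖ (`facetWidth`, `abs_coord_le`), so the simplex has inradius t/W with W = ∑ a_i w_i.

Kissing bound: if t/W > 3R_a, a rescaling turns the integer points into a set meeting every open
unit ball, and the inscribed ball has radius at least 3. A central unit ball and the balls touching
it are disjoint, fit inside, and contain distinct points. In dimension at least two a rotation of
the packing leaves one further point uncovered (`exists_finset_card_add_two`).

Volume bound: this is a discrete Blichfeldt argument. Move the facets inward by r > R_a and dilate
by `m`. If the result has more than s·m^(N-1) integer points, then s + 1 of them agree modulo mΛ_a;
divided by `m` and moved by at most `r`, they become s + 1 integer points of the simplex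
(`lt_encard_representations_of_lt_card`). Counting points by volume, letting m → ∞ and applying
Bernoulli's inequality give the stated bound. -/

namespace FrobeniusBound

/-! ### The lattice, its span and its covering radius -/

variable {N : ℕ} {a : Fin N → ℕ}

/-- The embedding of integer vectors into Euclidean space. -/
def intVec (y : Fin N → ℤ) : EuclideanSpace ℝ (Fin N) :=
  WithLp.toLp 2 fun i => (y i : ℝ)

@[simp] theorem intVec_apply (y : Fin N → ℤ) (i : Fin N) : intVec y i = (y i : ℝ) := rfl

theorem mem_lattice_iff {x : EuclideanSpace ℝ (Fin N)} :
    x ∈ lattice a ↔ ∃ y : Fin N → ℤ, ∑ i, (a i : ℤ) * y i = 0 ∧ intVec y = x := by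
  constructor
  · rintro ⟨h1, h2⟩
    choose y hy using h1
    refine ⟨y, ?_, ?_⟩
    · have : ((∑ i, (a i : ℤ) * y i : ℤ) : ℝ) = 0 := by
        push_cast
        simpa [hy] using h2
      exact_mod_cast this
    · ext i
      simp [hy]
  · rintro ⟨y, h1, rfl⟩
    refine ⟨fun i => ⟨y i, rfl⟩, ?_⟩
    have : ((∑ i, (a i : ℤ) * y i : ℤ) : ℝ) = 0 := by rw [h1]; simp
    simpa using this

/-- The lattice vector `a_k e_i - a_i e_k`. -/
def syzygy (a : Fin N → ℕ) (k i : Fin N) : Fin N → ℤ :=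
  fun j => (if j = i then (a k : ℤ) else 0) - if j = k then (a i : ℤ) else 0

theorem sum_mul_syzygy (k i : Fin N) : ∑ j, (a j : ℤ) * syzygy a k i j = 0 := by
  simp [syzygy, mul_sub, Finset.sum_sub_distrib, mul_comm]

theorem eq_sum_smul_syzygy {k : Fin N} (hk : 0 < a k) {x : EuclideanSpace ℝ (Fin N)}
    (hx : ∑ i, (a i : ℝ) * x i = 0) :
    x = ∑ i, (x i / a k) • intVec (syzygy a k i) := by
  have hk' : (a k : ℝ) ≠ 0 := by positivity
  ext j
  have : ∑ i, x i / a k * (if j = k then (a i : ℝ) else 0) = 0 := by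
    split_ifs
    · have : ∑ i, x i / a k * (a i : ℝ) = (∑ i, (a i : ℝ) * x i) / a k := by
        rw [Finset.sum_div]
        exact Finset.sum_congr rfl fun i _ => by ring
      rw [this, hx, zero_div]
    · simp
  rw [WithLp.ofLp_sum, Finset.sum_apply]
  simp only [PiLp.smul_apply, intVec_apply, syzygy, Int.cast_sub, Int.cast_ite, Int.cast_natCast,
    Int.cast_zero, smul_eq_mul, mul_sub, Finset.sum_sub_distrib, this]
  simp [hk']

theorem intVec_syzygy_mem_lattice (k i : Fin N) : intVec (syzygy a k i) ∈ lattice a :=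
  mem_lattice_iff.2 ⟨_, sum_mul_syzygy k i, rfl⟩

theorem mem_latticeSpan_iff (hN : 0 < N) (ha : ∀ i, 0 < a i) {x : EuclideanSpace ℝ (Fin N)} :
    x ∈ latticeSpan a ↔ ∑ i, (a i : ℝ) * x i = 0 := by
  constructor
  · intro hx
    induction hx using Submodule.span_induction with
    | mem x h => exact h.2
    | zero => simp
    | add x y _ _ hx hy => simp [mul_add, Finset.sum_add_distrib, hx, hy]
    | smul c x _ hx =>
      have : ∑ i, (a i : ℝ) * (c • x) i = c * ∑ i, (a i : ℝ) * x i := by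
        rw [Finset.mul_sum]
        exact Finset.sum_congr rfl fun i _ => by simp; ring
      rw [this, hx, mul_zero]
  · intro hx
    rw [eq_sum_smul_syzygy (ha ⟨0, hN⟩) hx]
    exact Submodule.sum_mem _ fun i _ => Submodule.smul_mem _ _
      (Submodule.subset_span (intVec_syzygy_mem_lattice _ i))

/-- Rounding down the coefficients over the syzygies leaves a bounded remainder. Without this the
infimum defining R_a could be the default value 0 of an empty set. -/
theorem exists_covering (hN : 0 < N) (ha : ∀ i, 0 < a i) :
    ∃ R : ℝ, 0 < R ∧
      lattice a + (Metric.closedBall 0 R ∩ (latticeSpan a : Set (EuclideanSpace ℝ (Fin N)))) =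
        (latticeSpan a : Set (EuclideanSpace ℝ (Fin N))) := by
  set k : Fin N := ⟨0, hN⟩
  refine ⟨∑ i, ‖intVec (syzygy a k i)‖ + 1, by positivity, Set.Subset.antisymm ?_ ?_⟩
  · rintro _ ⟨l, hl, v, hv, rfl⟩
    exact Submodule.add_mem _ (Submodule.subset_span hl) hv.2
  · intro x hx
    have hx' := (mem_latticeSpan_iff hN ha).1 hx
    have hl : ∑ i, (⌊x i / a k⌋ : ℝ) • intVec (syzygy a k i) ∈ lattice a := by
      refine mem_lattice_iff.2 ⟨∑ i, ⌊x i / a k⌋ • syzygy a k i, ?_, ?_⟩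
      · simp only [Finset.sum_apply, Pi.smul_apply, smul_eq_mul, Finset.mul_sum]
        rw [Finset.sum_comm]
        refine Finset.sum_eq_zero fun i _ => ?_
        have := sum_mul_syzygy (a := a) k i
        calc _ = ⌊x i / a k⌋ * ∑ j, (a j : ℤ) * syzygy a k i j := by
              rw [Finset.mul_sum]
              exact Finset.sum_congr rfl fun j _ => by ring
          _ = 0 := by rw [this, mul_zero]
      · ext j
        simp
    refine ⟨_, hl, x - ∑ i, (⌊x i / a k⌋ : ℝ) • intVec (syzygy a k i), ⟨?_, ?_⟩, by simp⟩
    · have h : x - ∑ i, (⌊x i / a k⌋ : ℝ) • intVec (syzygy a k i)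
          = ∑ i, Int.fract (x i / a k) • intVec (syzygy a k i) := by
        simp only [Int.fract, sub_smul, Finset.sum_sub_distrib]
        rw [← eq_sum_smul_syzygy (ha k) hx']
      rw [mem_closedBall_zero_iff, h]
      refine (norm_sum_le _ _).trans ((Finset.sum_le_sum fun i _ => ?_).trans
        (le_add_of_nonneg_right zero_le_one))
      rw [norm_smul, Real.norm_of_nonneg (Int.fract_nonneg _)]
      exact mul_le_of_le_one_left (norm_nonneg _) (Int.fract_lt_one _).le
    · exact Submodule.sub_mem _ hx (Submodule.subset_span hl)

theorem coveringRadius_nonneg : 0 ≤ coveringRadius a :=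
  Real.sInf_nonneg fun _ h => h.1.le

theorem exists_lattice_norm_sub_le (hN : 0 < N) (ha : ∀ i, 0 < a i) {r : ℝ}
    (hr : coveringRadius a < r) {x : EuclideanSpace ℝ (Fin N)}
    (hx : ∑ i, (a i : ℝ) * x i = 0) :
    ∃ y : Fin N → ℤ, ∑ i, (a i : ℤ) * y i = 0 ∧ ‖x - intVec y‖ ≤ r := by
  obtain ⟨R, ⟨-, hR⟩, hRr⟩ := exists_lt_of_csInf_lt (exists_covering hN ha) hr
  have hx' : x ∈ (latticeSpan a : Set (EuclideanSpace ℝ (Fin N))) :=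
    (mem_latticeSpan_iff hN ha).2 hx
  rw [← hR] at hx'
  obtain ⟨l, hl, v, hv, rfl⟩ := hx'
  obtain ⟨y, hy, rfl⟩ := mem_lattice_iff.1 hl
  refine ⟨y, hy, ?_⟩
  simpa using (mem_closedBall_zero_iff.1 hv.1).trans hRr.le

theorem exists_int_combination (hgcd : Finset.univ.gcd a = 1) (t : ℤ) :
    ∃ y : Fin N → ℤ, ∑ i, (a i : ℤ) * y i = t := by
  obtain ⟨g, hg⟩ := Finset.gcd_eq_sum_mul Finset.univ (fun i => (a i : ℤ))
  set d := Finset.univ.gcd fun i => (a i : ℤ) with hd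
  have h1 : d.natAbs ∣ 1 := by
    rw [← hgcd]
    refine Finset.dvd_gcd fun i _ => ?_
    exact Int.natAbs_dvd_natAbs.2 (Finset.gcd_dvd (f := fun i => (a i : ℤ)) (Finset.mem_univ i))
  obtain ⟨e, he⟩ : d ∣ 1 := by
    rw [← Int.natAbs_dvd_natAbs]; simpa using h1
  refine ⟨fun i => g i * (e * t), ?_⟩
  have : ∑ i, (a i : ℤ) * (g i * (e * t)) = (∑ i, (a i : ℤ) * g i) * (e * t) := by
    rw [Finset.sum_mul]
    exact Finset.sum_congr rfl fun i _ => by ring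
  rw [this]
  have hg' : d = ∑ i, (a i : ℤ) * g i := by rw [hg]
  rw [← hg', ← mul_assoc, ← he, one_mul]

/-- Integer points approximate the points of the hyperplane `a · p = t` up to any radius exceeding
the covering radius. -/
theorem exists_int_norm_sub_le (hN : 0 < N) (ha : ∀ i, 0 < a i)
    (hgcd : Finset.univ.gcd a = 1) {r : ℝ} (hr : coveringRadius a < r) (t : ℤ)
    {p : EuclideanSpace ℝ (Fin N)} (hp : ∑ i, (a i : ℝ) * p i = t) :
    ∃ y : Fin N → ℤ, ∑ i, (a i : ℤ) * y i = t ∧ ‖p - intVec y‖ ≤ r := by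
  obtain ⟨x₀, hx₀⟩ := exists_int_combination hgcd t
  have hx₀' : ∑ i, (a i : ℝ) * x₀ i = t := by exact_mod_cast hx₀
  obtain ⟨y, hy, hyr⟩ := exists_lattice_norm_sub_le hN ha hr (x := p - intVec x₀)
    (by simp [mul_sub, Finset.sum_sub_distrib, hp, hx₀'])
  refine ⟨x₀ + y, by simp [mul_add, Finset.sum_add_distrib, hx₀, hy], ?_⟩
  have : intVec (x₀ + y) = intVec x₀ + intVec y := by ext; simp
  rwa [this, ← sub_sub]

/-! ### Distances to the facets -/

theorem vecNorm_sq : vecNorm a ^ 2 = ∑ i, (a i : ℝ) ^ 2 := by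
  simp [vecNorm, EuclideanSpace.norm_sq_eq]

theorem sum_subtype_ne (i : Fin N) (f : Fin N → ℝ) :
    ∑ j : {j : Fin N // j ≠ i}, f j.1 = ∑ j ∈ Finset.univ.erase i, f j := by
  symm
  apply Finset.sum_subtype
  simp

theorem omitNorm_sq (i : Fin N) :
    omitNorm a i ^ 2 = ∑ j ∈ Finset.univ.erase i, (a j : ℝ) ^ 2 := by
  rw [← sum_subtype_ne i fun j => (a j : ℝ) ^ 2]
  simp [omitNorm, EuclideanSpace.norm_sq_eq]

theorem vecNorm_pos (hN : 0 < N) (ha : ∀ i, 0 < a i) : 0 < vecNorm a := by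
  have h : 0 < vecNorm a ^ 2 := by
    rw [vecNorm_sq]
    exact Finset.sum_pos (fun i _ => by have := ha i; positivity) ⟨⟨0, hN⟩, Finset.mem_univ _⟩
  exact lt_of_le_of_ne (norm_nonneg _) fun h0 => by simp [← h0] at h

theorem omitNorm_pos (hN : 2 ≤ N) (ha : ∀ i, 0 < a i) (i : Fin N) : 0 < omitNorm a i := by
  have : Nontrivial (Fin N) := Fin.nontrivial_iff_two_le.2 hN
  obtain ⟨j, hj⟩ := exists_ne i
  have h : 0 < omitNorm a i ^ 2 := by
    rw [omitNorm_sq]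
    exact Finset.sum_pos (fun i _ => by have := ha i; positivity) ⟨j, by simp [hj]⟩
  exact lt_of_le_of_ne (norm_nonneg _) fun h0 => by simp [← h0] at h

/-- The norm of the orthogonal projection of the `i`-th unit vector to the hyperplane `a · x = 0`. -/
noncomputable def facetWidth (a : Fin N → ℕ) (i : Fin N) : ℝ := omitNorm a i / vecNorm a

theorem facetWidth_nonneg (i : Fin N) : 0 ≤ facetWidth a i :=
  div_nonneg (norm_nonneg _) (norm_nonneg _)

theorem facetWidth_pos (hN : 2 ≤ N) (ha : ∀ i, 0 < a i) (i : Fin N) : 0 < facetWidth a i :=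
  div_pos (omitNorm_pos hN ha i) (vecNorm_pos (by omega) ha)

theorem sum_mul_facetWidth :
    ∑ i, (a i : ℝ) * facetWidth a i = (∑ i, omitNorm a i * (a i : ℝ)) / vecNorm a := by
  rw [Finset.sum_div]
  exact Finset.sum_congr rfl fun i _ => by rw [facetWidth]; ring

theorem sum_mul_facetWidth_pos (hN : 2 ≤ N) (ha : ∀ i, 0 < a i) :
    0 < ∑ i, (a i : ℝ) * facetWidth a i :=
  Finset.sum_pos (fun i _ => mul_pos (by exact_mod_cast ha i) (facetWidth_pos hN ha i))
    ⟨⟨0, by omega⟩, Finset.mem_univ _⟩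

/-- Cauchy–Schwarz on a_i z_i = -∑_{j≠i} a_j z_j gives a_i² z_i² ≤ ‖α_i‖² (‖z‖² - z_i²); collect the
z_i² terms. -/
theorem abs_coord_le (hN : 0 < N) (ha : ∀ i, 0 < a i) {z : EuclideanSpace ℝ (Fin N)}
    (hz : ∑ i, (a i : ℝ) * z i = 0) (i : Fin N) : |z i| ≤ facetWidth a i * ‖z‖ := by
  have hv := vecNorm_pos hN ha
  rw [facetWidth, div_mul_eq_mul_div, le_div_iff₀ hv]
  have ho : 0 ≤ omitNorm a i := norm_nonneg _
  refine (pow_le_pow_iff_left₀ (by positivity) (by positivity) two_ne_zero).1 ?_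
  have h1 : (a i : ℝ) * z i = -∑ j ∈ Finset.univ.erase i, (a j : ℝ) * z j := by
    rw [← Finset.add_sum_erase _ _ (Finset.mem_univ i)] at hz
    linarith
  have h2 := Finset.sum_mul_sq_le_sq_mul_sq (Finset.univ.erase i) (fun j => (a j : ℝ)) fun j => z j
  have h3 : ‖z‖ ^ 2 = z i ^ 2 + ∑ j ∈ Finset.univ.erase i, z j ^ 2 := by
    rw [Finset.add_sum_erase _ (fun j => z j ^ 2) (Finset.mem_univ i), EuclideanSpace.norm_sq_eq]
    simp
  have h4 : vecNorm a ^ 2 = (a i : ℝ) ^ 2 + omitNorm a i ^ 2 := by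
    rw [vecNorm_sq, omitNorm_sq, Finset.add_sum_erase _ (fun j => (a j : ℝ) ^ 2) (Finset.mem_univ i)]
  rw [← omitNorm_sq, ← neg_sq, ← h1] at h2
  rw [mul_pow, mul_pow, sq_abs, h4, h3]
  nlinarith

theorem card_le_encard_representations {t : ℕ} (Y : Finset (Fin N → ℤ))
    (hY : ∀ y ∈ Y, ∑ i, (a i : ℤ) * y i = t ∧ ∀ i, 0 ≤ y i) :
    (Y.card : ℕ∞) ≤ (representations a t).encard := by
  rw [← Set.encard_coe_eq_coe_finsetCard]
  refine Set.encard_le_encard_of_injOn (f := fun y i => (y i).toNat) ?_ ?_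
  · intro y hy
    obtain ⟨h1, h2⟩ := hY y hy
    have : ((∑ i, a i * (y i).toNat : ℕ) : ℤ) = t := by
      rw [← h1]
      push_cast
      exact Finset.sum_congr rfl fun i _ => by rw [Int.toNat_of_nonneg (h2 i)]
    exact_mod_cast this
  · intro y hy y' hy' h
    funext i
    have := congrFun h i
    have h1 := (hY y hy).2 i
    have h2 := (hY y' hy').2 i
    simp only at this
    omega

end FrobeniusBound

/-! ### Kissing configurations and sets meeting all unit balls -/

namespace FrobeniusBound

variable {E : Type*} [NormedAddCommGroup E] [InnerProductSpace ℝ E]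

/-- In dimension at least two, pairwise disjoint open unit balls with centres at distance `2` from
the origin do not cover any sphere around the origin. -/
theorem exists_norm_eq_forall_one_le_dist (hE : 1 < Module.rank ℝ E) {S : Set E}
    (hS : ∀ x ∈ S, ‖x‖ = 2) (hS' : S.Pairwise fun x y => 2 ≤ dist x y) {ρ : ℝ} (hρ : 0 ≤ ρ) :
    ∃ w : E, ‖w‖ = ρ ∧ ∀ x ∈ S, 1 ≤ dist w x := by
  by_contra! H
  obtain ⟨w₀, hw₀⟩ := (isConnected_sphere hE (0 : E) hρ).nonempty
  obtain ⟨v, hv, hvw⟩ := H w₀ (by simpa using hw₀)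
  -- A connected sphere covered by disjoint open balls lies in one of them.
  have hsub : Metric.sphere (0 : E) ρ ⊆ Metric.ball v 1 := by
    refine (isPreconnected_sphere hE (0 : E) ρ).subset_left_of_subset_union
      (v := ⋃ x ∈ S \ {v}, Metric.ball x 1) Metric.isOpen_ball
      (isOpen_biUnion fun x _ => Metric.isOpen_ball) ?_ ?_ ⟨w₀, hw₀, hvw⟩
    · rw [Set.disjoint_iUnion₂_right]
      intro x hx
      refine Metric.ball_disjoint_ball ?_
      have := hS' hv hx.1 (fun h => hx.2 h.symm)
      linarith
    · intro w hw
      obtain ⟨x, hx, hxw⟩ := H w (by simpa using hw)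
      by_cases h : x = v
      · left; rw [← h]; exact hxw
      · right
        exact Set.mem_biUnion (show x ∈ S \ {v} from ⟨hx, h⟩) hxw
  have h1 := hsub hw₀
  have h2 := hsub (show -w₀ ∈ Metric.sphere (0 : E) ρ by simpa using hw₀)
  rw [Metric.mem_ball, dist_eq_norm] at h1 h2
  have h3 : ‖(w₀ - v) + (-w₀ - v)‖ < 2 := (norm_add_le _ _).trans_lt (by linarith)
  have h4 : (w₀ - v) + (-w₀ - v) = -((2 : ℝ) • v) := by rw [two_smul]; abel
  rw [h4, norm_neg, norm_smul, hS v hv] at h3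
  norm_num at h3

/-- A set meeting all open unit balls has distinct points in the balls of a packing. -/
theorem exists_injOn_mem_ball {E : Type*} [NormedAddCommGroup E] {L : Set E} (hL : ∀ x : E, ∃ y ∈ L, dist y x < 1) {S : Set E}
    (hS : S.Pairwise fun x y => 2 ≤ dist x y) :
    ∃ f : E → E, (∀ x, f x ∈ L ∧ dist (f x) x < 1) ∧ Set.InjOn f S := by
  choose f hf using hL
  refine ⟨f, hf, fun x hx y hy hxy => ?_⟩
  by_contra hne
  have h1 := hS hx hy hne
  have h2 := (hf x).2
  have h3 := (hf y).2
  rw [← hxy] at h3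
  have := dist_triangle_left x y (f x)
  linarith

theorem pairwise_insert_zero {E : Type*} [NormedAddCommGroup E] {S : Set E}
    (hS : ∀ x ∈ S, ‖x‖ = 2) (hS' : S.Pairwise fun x y => 2 ≤ dist x y) :
    (insert (0 : E) S).Pairwise fun x y => 2 ≤ dist x y := by
  refine Set.Pairwise.insert hS' fun y hy _ => ?_
  simp [hS y hy]

/-- The balls around 0 and around `S` are disjoint, so each contributes its own point, of norm below
2 + 1. The last clause records which balls were used, so that a point outside them all can be added.
-/
theorem exists_finset_card_add_one {E : Type*} [NormedAddCommGroup E] {L : Set E} (hL : ∀ x : E, ∃ y ∈ L, dist y x < 1)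
    {S : Finset E} (hS : ∀ x ∈ S, ‖x‖ = 2)
    (hS' : (S : Set E).Pairwise fun x y => 2 ≤ dist x y) :
    ∃ T : Finset E, (∀ y ∈ T, y ∈ L ∧ ‖y‖ ≤ 3) ∧ S.card + 1 ≤ T.card ∧
      ∀ y ∈ T, ∃ x ∈ insert (0 : E) (S : Set E), dist y x < 1 := by
  classical
  obtain ⟨f, hf, hinj⟩ := exists_injOn_mem_ball hL (pairwise_insert_zero hS hS')
  have h0 : (0 : E) ∉ S := fun h => by simpa using hS 0 h
  refine ⟨(insert 0 S).image f, ?_, ?_, ?_⟩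
  · intro y hy
    obtain ⟨x, hx, rfl⟩ := Finset.mem_image.1 hy
    refine ⟨(hf x).1, ?_⟩
    have h1 := (hf x).2
    have h2 : ‖x‖ ≤ 2 := by
      rcases Finset.mem_insert.1 hx with rfl | hx
      · simp
      · exact (hS x hx).le
    rw [dist_eq_norm] at h1
    have := norm_le_insert' (f x) x
    linarith
  · rw [Finset.card_image_of_injOn (by simpa using hinj), Finset.card_insert_of_notMem h0]
  · intro y hy
    obtain ⟨x, hx, rfl⟩ := Finset.mem_image.1 hy
    exact ⟨x, by simpa using hx, (hf x).2⟩

/-- In dimension at least two the packing can be rotated so as to miss a point of the set. -/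
theorem exists_finset_card_add_two (hE : 1 < Module.rank ℝ E) {L : Set E}
    (hL : ∀ x : E, ∃ y ∈ L, dist y x < 1) {S : Finset E} (hne : S.Nonempty)
    (hS : ∀ x ∈ S, ‖x‖ = 2) (hS' : (S : Set E).Pairwise fun x y => 2 ≤ dist x y) :
    ∃ T : Finset E, (∀ y ∈ T, y ∈ L ∧ ‖y‖ ≤ 3) ∧ S.card + 2 ≤ T.card := by
  classical
  obtain ⟨v, hv⟩ := hne
  obtain ⟨q, hqL, hq⟩ := hL v
  obtain ⟨w, hw, hwS⟩ := exists_norm_eq_forall_one_le_dist hE (S := S) hS hS' (norm_nonneg q)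
  -- Since ‖w‖ = ‖q‖, the reflection in the hyperplane orthogonal to w - q takes `w` to `q`.
  obtain ⟨e, he⟩ : ∃ e : E ≃ₗᵢ[ℝ] E, e w = q := ⟨_, Submodule.reflection_sub hw⟩
  have hinj := e.injective.injOn (s := (S : Set E))
  obtain ⟨T, hT, hcard, hball⟩ := exists_finset_card_add_one hL (S := S.image e)
    (by simpa using hS) (by
      rw [Finset.coe_image, Set.InjOn.pairwise_image hinj]
      intro x hx y hy hxy
      simpa [Function.onFun] using hS' hx hy hxy)
  rw [Finset.card_image_of_injOn hinj] at hcard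
  have hv2 := hS v hv
  rw [dist_eq_norm] at hq
  -- The central ball misses `q` because ‖q‖ > ‖v‖ - 1 = 1; the moved balls miss it because the
  -- original ones miss `w`.
  have hqT : q ∉ T := fun hqT => by
    obtain ⟨x, hx, hqx⟩ := hball q hqT
    rcases hx with rfl | hx
    · have := norm_le_insert q v
      rw [dist_zero_right] at hqx
      linarith
    · rw [Finset.coe_image] at hx
      obtain ⟨u, hu, rfl⟩ := hx
      rw [← he, e.dist_map] at hqx
      exact absurd hqx (not_lt.2 (hwS u hu))
  refine ⟨insert q T, ?_, by rw [Finset.card_insert_of_notMem hqT]; omega⟩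
  intro y hy
  rcases Finset.mem_insert.1 hy with rfl | hy
  · refine ⟨hqL, ?_⟩
    have := norm_le_insert' y v
    linarith
  · exact hT y hy

/-- Starting from k - 1 < τ_m means that the supremum need not be known to be attained. -/
theorem exists_kissing_finset {m k : ℕ} (hk : 0 < k) (h : (k : ℕ∞) ≤ kissingNumber m) :
    ∃ S : Finset (EuclideanSpace ℝ (Fin m)), S.card = k ∧ (∀ x ∈ S, ‖x‖ = 2) ∧
      (S : Set (EuclideanSpace ℝ (Fin m))).Pairwise fun x y => 2 ≤ dist x y := by
  have h1 : ((k - 1 : ℕ) : ℕ∞) < kissingNumber m :=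
    lt_of_lt_of_le (by exact_mod_cast Nat.sub_lt hk one_pos) h
  simp only [kissingNumber, lt_iSup_iff] at h1
  obtain ⟨S, ⟨hS, hS'⟩, hlt⟩ := h1
  have h2 : (k : ℕ∞) ≤ S.encard := by
    have := Order.add_one_le_of_lt hlt
    have h3 : ((k - 1 : ℕ) : ℕ∞) + 1 = k := by exact_mod_cast Nat.sub_add_cancel hk
    rwa [h3] at this
  obtain ⟨T, hTS, hT⟩ := Set.exists_subset_encard_eq h2
  have hfin : T.Finite := Set.finite_of_encard_eq_coe hT
  refine ⟨hfin.toFinset, ?_, fun x hx => hS x (hTS (by simpa using hx)), ?_⟩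
  · rw [hfin.encard_eq_coe_toFinset_card] at hT
    exact_mod_cast hT
  · rw [hfin.coe_toFinset]
    exact hS'.mono hTS

theorem eq_single_of_norm_eq_two {x : EuclideanSpace ℝ (Fin 1)} (hx : ‖x‖ = 2) :
    x = EuclideanSpace.single 0 2 ∨ x = EuclideanSpace.single 0 (-2) := by
  have h : |x 0| = 2 := by simpa [EuclideanSpace.norm_eq, Real.sqrt_sq_eq_abs] using hx
  rcases eq_or_eq_neg_of_abs_eq h with h | h
  · left; ext i; fin_cases i; simpa using h
  · right; ext i; fin_cases i; simpa using h

theorem kissingNumber_one_le : kissingNumber 1 ≤ 2 := by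
  refine iSup₂_le fun S hS => ?_
  refine (Set.encard_le_encard (t := {EuclideanSpace.single 0 2, EuclideanSpace.single 0 (-2)})
    fun x hx => by simpa using eq_single_of_norm_eq_two (hS.1 x hx)).trans ?_
  exact (Set.encard_insert_le _ _).trans (by rw [Set.encard_singleton]; norm_num)

theorem exists_kissing_pair : ∃ S : Finset (EuclideanSpace ℝ (Fin 1)), S.card = 2 ∧
    (∀ x ∈ S, ‖x‖ = 2) ∧
      (S : Set (EuclideanSpace ℝ (Fin 1))).Pairwise fun x y => 2 ≤ dist x y := by
  classical
  set u : EuclideanSpace ℝ (Fin 1) := EuclideanSpace.single 0 2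
  have hu : ‖u‖ = 2 := by simp [u]
  have hd : dist u (-u) = 4 := by
    rw [dist_eq_norm, sub_neg_eq_add, ← two_smul ℝ u, norm_smul, hu]; norm_num
  have hne : u ≠ -u := fun h => by
    rw [← h, dist_self] at hd
    norm_num at hd
  refine ⟨{u, -u}, Finset.card_pair hne, by simp [hu], ?_⟩
  rw [Finset.coe_pair, Set.pairwise_pair]
  intro _
  rw [dist_comm (-u) u, hd]
  norm_num

end FrobeniusBound

/-! ### The inscribed ball and the kissing number bound -/

namespace FrobeniusBound

variable {N : ℕ} {a : Fin N → ℕ}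

theorem finrank_latticeSpan (hN : 0 < N) (ha : ∀ i, 0 < a i) :
    Module.finrank ℝ (latticeSpan a) = N - 1 := by
  set b : EuclideanSpace ℝ (Fin N) := WithLp.toLp 2 fun j => (a j : ℝ)
  have hb : b ≠ 0 := fun h => by
    have := congrArg (fun v : EuclideanSpace ℝ (Fin N) => v ⟨0, hN⟩) h
    simp [b, (ha _).ne'] at this
  have h : latticeSpan a = (Submodule.span ℝ {b})ᗮ := by
    ext x
    rw [mem_latticeSpan_iff hN ha, Submodule.mem_orthogonal_singleton_iff_inner_left]
    simp [PiLp.inner_apply, b]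
  rw [h]
  have : Fact (Module.finrank ℝ (EuclideanSpace ℝ (Fin N)) = (N - 1) + 1) :=
    ⟨by rw [finrank_euclideanSpace_fin]; omega⟩
  exact Submodule.finrank_orthogonal_span_singleton hb

theorem exists_linearIsometryEquiv_latticeSpan (hN : 0 < N) (ha : ∀ i, 0 < a i) :
    Nonempty (EuclideanSpace ℝ (Fin (N - 1)) ≃ₗᵢ[ℝ] latticeSpan a) :=
  ⟨((stdOrthonormalBasis ℝ (latticeSpan a)).reindex
    (finCongr (finrank_latticeSpan hN ha))).repr.symm⟩

/-- The centre of the inscribed ball of the simplex `a · x = t`, `x ≥ 0`. -/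
noncomputable def incentre (a : Fin N → ℕ) (t : ℕ) : EuclideanSpace ℝ (Fin N) :=
  WithLp.toLp 2 fun i => t / (∑ j, (a j : ℝ) * facetWidth a j) * facetWidth a i

theorem sum_mul_incentre (hN : 2 ≤ N) (ha : ∀ i, 0 < a i) (t : ℕ) :
    ∑ i, (a i : ℝ) * incentre a t i = t := by
  have hW := sum_mul_facetWidth_pos hN ha
  have : ∑ i, (a i : ℝ) * incentre a t i =
      t / (∑ j, (a j : ℝ) * facetWidth a j) * ∑ j, (a j : ℝ) * facetWidth a j := by
    rw [Finset.mul_sum]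
    exact Finset.sum_congr rfl fun i _ => by simp [incentre]; ring
  rw [this, div_mul_cancel₀ _ hW.ne']

/-- The incentre has distance t/W from every facet hyperplane, so a move of length ρ ≤ t/W keeps all
coordinates nonnegative. -/
theorem nonneg_of_norm_incentre_sub_le (hN : 2 ≤ N) (ha : ∀ i, 0 < a i) {t : ℕ} {ρ : ℝ}
    (hρ : ρ * (∑ j, (a j : ℝ) * facetWidth a j) ≤ t) {y : Fin N → ℤ}
    (hy : ∑ i, (a i : ℤ) * y i = t) (hd : ‖incentre a t - intVec y‖ ≤ ρ) (i : Fin N) : 0 ≤ y i := by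
  have hW := sum_mul_facetWidth_pos hN ha
  have hy' : ∑ i, (a i : ℝ) * y i = t := by exact_mod_cast hy
  have h1 := abs_coord_le (by omega) ha (z := incentre a t - intVec y)
    (by simp only [PiLp.sub_apply, intVec_apply, mul_sub, Finset.sum_sub_distrib]
        rw [hy', sum_mul_incentre hN ha, sub_self]) i
  have hw := facetWidth_nonneg (a := a) i
  have h2 := mul_le_mul_of_nonneg_left hd hw
  have h3 := mul_le_mul_of_nonneg_right ((le_div_iff₀ hW).2 hρ) hw
  have h4 := (le_abs_self _).trans (h1.trans h2)
  simp only [PiLp.sub_apply, intVec_apply, incentre] at h4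
  have : (0 : ℝ) ≤ y i := by linarith
  exact_mod_cast this

/-- If the inradius of the simplex exceeds three times the covering radius, then the integer
points in it contain, after rescaling, the points found in a ball of radius `3` for every set that
meets all open unit balls. -/
theorem le_encard_representations_of_ball (hN : 2 ≤ N) (ha : ∀ i, 0 < a i)
    (hgcd : Finset.univ.gcd a = 1) {t k : ℕ}
    (ht : 3 * coveringRadius a * (∑ j, (a j : ℝ) * facetWidth a j) < t)
    (hk : ∀ L : Set (EuclideanSpace ℝ (Fin (N - 1))), (∀ x, ∃ y ∈ L, dist y x < 1) →
      ∃ T : Finset (EuclideanSpace ℝ (Fin (N - 1))), (∀ y ∈ T, y ∈ L ∧ ‖y‖ ≤ 3) ∧ k ≤ T.card) :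
    (k : ℕ∞) ≤ (representations a t).encard := by
  classical
  have hW := sum_mul_facetWidth_pos hN ha
  have hlt : coveringRadius a < t / (∑ j, (a j : ℝ) * facetWidth a j) / 3 := by
    rw [lt_div_iff₀ (by norm_num), lt_div_iff₀ hW]
    linarith
  -- Covering with radius `r₀` and rescaling by the larger `r` makes distances strictly less than 1.
  obtain ⟨r₀, hr₀, hlt₀⟩ := exists_between hlt
  obtain ⟨r, hr, hlt⟩ := exists_between hlt₀
  have hr0 : 0 < r := coveringRadius_nonneg.trans_lt (hr₀.trans hr)
  have hr3 : 3 * r * (∑ j, (a j : ℝ) * facetWidth a j) ≤ t := by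
    rw [lt_div_iff₀ (by norm_num), lt_div_iff₀ hW] at hlt
    linarith
  obtain ⟨ψ⟩ := exists_linearIsometryEquiv_latticeSpan (a := a) (by omega) ha
  set p := incentre a t
  have hp : ∑ i, (a i : ℝ) * p i = t := sum_mul_incentre hN ha t
  obtain ⟨T, hT, hkT⟩ := hk {x | ∃ y : Fin N → ℤ, ∑ i, (a i : ℤ) * y i = t ∧
      p + r • (ψ x : EuclideanSpace ℝ (Fin N)) = intVec y} (by
    intro x
    have hx := (mem_latticeSpan_iff (by omega) ha).1 (ψ x).2
    obtain ⟨y, hy, hyr⟩ := exists_int_norm_sub_le (by omega) ha hgcd hr₀ t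
      (p := p + r • (ψ x : EuclideanSpace ℝ (Fin N))) (by
        have : ∑ i, (a i : ℝ) * (r * (ψ x : EuclideanSpace ℝ (Fin N)) i) = 0 := by
          simp only [mul_left_comm _ r]
          rw [← Finset.mul_sum, hx, mul_zero]
        simp [mul_add, Finset.sum_add_distrib, hp, this])
    have hy' : ∑ i, (a i : ℝ) * y i = t := by exact_mod_cast hy
    have hv : r⁻¹ • (intVec y - p) ∈ latticeSpan a := by
      refine Submodule.smul_mem _ _ ((mem_latticeSpan_iff (by omega) ha).2 ?_)
      simp [mul_sub, Finset.sum_sub_distrib, hy', hp]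
    refine ⟨ψ.symm ⟨_, hv⟩, ⟨y, hy, ?_⟩, ?_⟩
    · simp [smul_smul, hr0.ne']
    · rw [← ψ.dist_map, ψ.apply_symm_apply, Subtype.dist_eq, dist_comm, dist_eq_norm]
      have : (ψ x : EuclideanSpace ℝ (Fin N)) - r⁻¹ • (intVec y - p) =
          r⁻¹ • (p + r • (ψ x : EuclideanSpace ℝ (Fin N)) - intVec y) := by
        rw [smul_sub, smul_sub, smul_add, smul_smul, inv_mul_cancel₀ hr0.ne', one_smul]
        abel
      rw [this, norm_smul, norm_inv, Real.norm_of_nonneg hr0.le, inv_mul_lt_iff₀ hr0]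
      linarith)
  choose! Y hY using fun x hx => (hT x hx).1
  have hinj : Set.InjOn Y T := by
    intro x hx x' hx' h
    have h1 := (hY x hx).2
    rw [h, ← (hY x' hx').2, add_right_inj, smul_right_inj hr0.ne', Subtype.coe_inj] at h1
    exact ψ.injective h1
  refine le_trans ?_ (card_le_encard_representations (T.image Y) ?_)
  · rw [Finset.card_image_of_injOn hinj]
    exact_mod_cast hkT
  · intro y hy
    obtain ⟨x, hx, rfl⟩ := Finset.mem_image.1 hy
    refine ⟨(hY x hx).1, nonneg_of_norm_incentre_sub_le hN ha hr3 (hY x hx).1 ?_⟩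
    rw [← (hY x hx).2, norm_sub_rev, add_sub_cancel_left, norm_smul, Real.norm_of_nonneg hr0.le,
      mul_comm 3 r]
    refine mul_le_mul_of_nonneg_left ?_ hr0.le
    exact (ψ.norm_map x).trans_le (hT x hx).2

/-- The bound on `g_s(a)` in terms of the kissing number. -/
theorem lt_encard_representations_of_le_kissingNumber (hN : 2 ≤ N) (ha : ∀ i, 0 < a i)
    (hgcd : Finset.univ.gcd a = 1) {s t : ℕ}
    (hs : (s : ℕ∞) ≤ kissingNumber (N - 1) + 1) (hNs : ¬(N = 2 ∧ s = 3))
    (ht : 3 * coveringRadius a * (∑ j, (a j : ℝ) * facetWidth a j) < t) :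
    (s : ℕ∞) < (representations a t).encard := by
  suffices h : ((s + 1 : ℕ) : ℕ∞) ≤ (representations a t).encard from
    lt_of_lt_of_le (by exact_mod_cast Nat.lt_succ_self s) h
  refine le_encard_representations_of_ball hN ha hgcd ht fun L hL => ?_
  rcases hN.eq_or_lt with rfl | hN
  · have h3 : (s : ℕ∞) ≤ 3 := hs.trans (by
      refine (add_le_add_left kissingNumber_one_le 1).trans ?_
      norm_num)
    have h3 : s ≤ 3 := by exact_mod_cast h3
    obtain ⟨S, hS, hS2, hSd⟩ := exists_kissing_pair
    obtain ⟨T, hT, hc, -⟩ := exists_finset_card_add_one hL hS2 hSd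
    exact ⟨T, hT, by omega⟩
  · have hrank : 1 < Module.rank ℝ (EuclideanSpace ℝ (Fin (N - 1))) := by
      rw [← Module.finrank_eq_rank, finrank_euclideanSpace_fin]
      exact_mod_cast (by omega : 1 < N - 1)
    -- A packing of s - 1 balls yields s + 1 points; the maximum keeps it nonempty when s ≤ 1.
    obtain ⟨S, hS, hS2, hSd⟩ : ∃ S : Finset (EuclideanSpace ℝ (Fin (N - 1))), S.card = max (s - 1) 1 ∧
        (∀ x ∈ S, ‖x‖ = 2) ∧
        (S : Set (EuclideanSpace ℝ (Fin (N - 1)))).Pairwise fun x y => 2 ≤ dist x y := by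
      rcases le_or_gt s 1 with h | h
      · refine ⟨{EuclideanSpace.single ⟨0, by omega⟩ 2}, ?_, by simp, by simp⟩
        rw [Finset.card_singleton]; omega
      · rw [max_eq_left (by omega)]
        refine exists_kissing_finset (by omega) ?_
        have : (s : ℕ∞) = ((s - 1 : ℕ) : ℕ∞) + 1 := by
          exact_mod_cast (Nat.sub_add_cancel h.le).symm
        rw [this] at hs
        exact (ENat.add_le_add_iff_right (by simp)).1 hs
    obtain ⟨T, hT, hc⟩ := exists_finset_card_add_two hrank hL
      (Finset.card_pos.1 (by omega)) hS2 hSd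
    exact ⟨T, hT, by omega⟩

end FrobeniusBound

/-! ### Counting integer points of simplices by volume -/

namespace FrobeniusBound

variable {N : ℕ} {a : Fin N → ℕ}

theorem add_pow_succ_le (u b n : ℕ) :
    (u + b) ^ (n + 1) ≤ u ^ (n + 1) + (n + 1) * b * (u + b) ^ n := by
  induction n with
  | zero => simp
  | succ n ih =>
    have h : b * u ^ (n + 1) ≤ b * (u + b) ^ (n + 1) :=
      Nat.mul_le_mul_left _ (Nat.pow_le_pow_left (Nat.le_add_right _ _) _)
    calc (u + b) ^ (n + 1 + 1) = (u + b) * (u + b) ^ (n + 1) := by ring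
      _ ≤ (u + b) * (u ^ (n + 1) + (n + 1) * b * (u + b) ^ n) := Nat.mul_le_mul_left _ ih
      _ = u ^ (n + 1 + 1) + b * u ^ (n + 1) + (n + 1) * b * (u + b) ^ (n + 1) := by ring
      _ ≤ u ^ (n + 1 + 1) + b * (u + b) ^ (n + 1) + (n + 1) * b * (u + b) ^ (n + 1) := by omega
      _ = u ^ (n + 1 + 1) + (n + 1 + 1) * b * (u + b) ^ (n + 1) := by ring

/-- A lower Riemann sum estimate for the power function. -/
theorem pow_succ_le_sum_range {b : ℕ} (hb : 0 < b) (n t : ℕ) :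
    t ^ (n + 1) ≤ (n + 1) * b * ∑ k ∈ Finset.range (t / b + 1), (t - b * k) ^ n := by
  induction t using Nat.strong_induction_on with
  | _ t ih =>
    rcases lt_or_ge t b with h | h
    · rw [Nat.div_eq_of_lt h]
      simp only [zero_add, Finset.sum_range_one, mul_zero, Nat.sub_zero]
      rw [pow_succ']
      exact Nat.mul_le_mul_right _ (h.le.trans (Nat.le_mul_of_pos_left _ (Nat.succ_pos n)))
    · obtain ⟨u, rfl⟩ := Nat.exists_eq_add_of_le' h
      have := ih u (by omega)
      rw [Nat.add_div_right _ hb, Finset.sum_range_succ']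
      have h2 : ∀ k, u + b - b * (k + 1) = u - b * k := fun k => by
        rw [mul_add, mul_one]; omega
      simp only [h2, mul_zero, Nat.sub_zero]
      rw [mul_add]
      exact (add_pow_succ_le u b n).trans (Nat.add_le_add_right this _)

/-- The nonnegative integer solutions of `a · y ≤ t`, for positive `a`. -/
def solutionsLE (a : Fin N → ℕ) (t : ℕ) : Finset (Fin N → ℕ) :=
  (Fintype.piFinset fun _ => Finset.range (t + 1)).filter fun y => ∑ i, a i * y i ≤ t

/-- The nonnegative integer solutions of `a · y = t`, for positive `a`. -/
def solutionsEq (a : Fin N → ℕ) (t : ℕ) : Finset (Fin N → ℕ) :=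
  (solutionsLE a t).filter fun y => ∑ i, a i * y i = t

theorem mem_solutionsLE (ha : ∀ i, 0 < a i) {t : ℕ} {y : Fin N → ℕ} :
    y ∈ solutionsLE a t ↔ ∑ i, a i * y i ≤ t := by
  simp only [solutionsLE, Finset.mem_filter, Fintype.mem_piFinset, Finset.mem_range,
    and_iff_right_iff_imp]
  intro h i
  have h1 : a i * y i ≤ ∑ i, a i * y i :=
    Finset.single_le_sum (f := fun i => a i * y i) (fun _ _ => Nat.zero_le _) (Finset.mem_univ i)
  have h2 : y i ≤ a i * y i := Nat.le_mul_of_pos_left _ (ha i)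
  omega

theorem mem_solutionsEq (ha : ∀ i, 0 < a i) {t : ℕ} {y : Fin N → ℕ} :
    y ∈ solutionsEq a t ↔ ∑ i, a i * y i = t := by
  rw [solutionsEq, Finset.mem_filter, mem_solutionsLE ha]
  exact ⟨fun h => h.2, fun h => ⟨h.le, h⟩⟩

/-- Slicing by the first coordinate reduces the count to the Riemann sum estimate. -/
theorem pow_le_card_solutionsLE {n : ℕ} {a : Fin n → ℕ} (ha : ∀ i, 0 < a i) (t : ℕ) :
    t ^ n ≤ n.factorial * (∏ i, a i) * (solutionsLE a t).card := by
  induction n generalizing t with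
  | zero =>
    have : (solutionsLE a t).Nonempty := ⟨fun i => i.elim0, (mem_solutionsLE ha).2 (by simp)⟩
    simpa using this
  | succ n ih =>
    have h1 : ∑ k ∈ Finset.range (t / a 0 + 1),
        (solutionsLE (fun i : Fin n => a i.succ) (t - a 0 * k)).card ≤ (solutionsLE a t).card := by
      rw [← Finset.card_sigma]
      refine Finset.card_le_card_of_injOn (fun p => Fin.cons p.1 p.2) ?_ ?_
      · rintro ⟨k, y⟩ hp
        simp only [Finset.coe_sigma, Set.mem_sigma_iff, Finset.mem_coe, Finset.mem_range,
          mem_solutionsLE fun i : Fin n => ha i.succ] at hp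
        have hk : a 0 * k ≤ t := by
          rw [mul_comm]
          exact (Nat.le_div_iff_mul_le (ha 0)).1 (by omega)
        simp only [Finset.mem_coe, mem_solutionsLE ha, Fin.sum_univ_succ, Fin.cons_zero,
          Fin.cons_succ]
        omega
      · rintro ⟨k, y⟩ _ ⟨k', y'⟩ _ h
        obtain ⟨rfl, rfl⟩ := Fin.cons_injective2 h
        rfl
    calc t ^ (n + 1)
        ≤ (n + 1) * a 0 * ∑ k ∈ Finset.range (t / a 0 + 1), (t - a 0 * k) ^ n :=
          pow_succ_le_sum_range (ha 0) n t
      _ ≤ (n + 1) * a 0 * ∑ k ∈ Finset.range (t / a 0 + 1), n.factorial * (∏ i : Fin n, a i.succ) *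
            (solutionsLE (fun i : Fin n => a i.succ) (t - a 0 * k)).card :=
          Nat.mul_le_mul_left _ (Finset.sum_le_sum fun k _ => ih (fun i => ha i.succ) _)
      _ = (n + 1).factorial * (∏ i, a i) * ∑ k ∈ Finset.range (t / a 0 + 1),
            (solutionsLE (fun i : Fin n => a i.succ) (t - a 0 * k)).card := by
          rw [← Finset.mul_sum, Fin.prod_univ_succ, Nat.factorial_succ]
          ring
      _ ≤ _ := Nat.mul_le_mul_left _ h1

/-- If all integers from `F` on are representable, then the number of representations is at least
the normalized volume of the simplex, up to a shift by `F`. -/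
theorem pow_le_card_solutionsEq {n : ℕ} {a : Fin (n + 1) → ℕ} (ha : ∀ i, 0 < a i) {F : ℕ}
    (hF : ∀ m ≥ F, ∃ c : Fin (n + 1) → ℕ, ∑ i, a i * c i = m) (t : ℕ) :
    t ^ n ≤ n.factorial * (∏ i, a i) * (solutionsEq a (t + F)).card := by
  have ha' : ∀ i : Fin n, 0 < a i.succ := fun i => ha i.succ
  have h1 : (solutionsLE (fun i : Fin n => a i.succ) t).card ≤
      (solutionsEq a (t + F)).card * (Finset.range (a 0)).card := by
    refine Finset.card_le_mul_card_image_of_maps_to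
      (f := fun y => (t - ∑ i : Fin n, a i.succ * y i) % a 0)
      (fun y _ => Finset.mem_range.2 (Nat.mod_lt _ (ha 0))) _ fun j hj => ?_
    -- On the class of remainder `j` the first coordinate is forced to be the quotient; adding a
    -- fixed representation of F + j restores the total t + F.
    obtain ⟨c, hc⟩ := hF (F + j) (by omega)
    refine Finset.card_le_card_of_injOn
      (fun y => Fin.cons ((t - ∑ i : Fin n, a i.succ * y i) / a 0) y + c) ?_ ?_
    · intro y hy
      simp only [Finset.coe_filter, Set.mem_ofPred_eq, mem_solutionsLE ha'] at hy
      have := Nat.div_add_mod (t - ∑ i : Fin n, a i.succ * y i) (a 0)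
      simp only [Finset.mem_coe, mem_solutionsEq ha, Pi.add_apply, mul_add,
        Finset.sum_add_distrib, hc]
      rw [Fin.sum_univ_succ]
      simp only [Fin.cons_zero, Fin.cons_succ]
      omega
    · intro y _ y' _ h
      exact (Fin.cons_injective2 (add_right_cancel h)).2
  rw [Finset.card_range] at h1
  calc t ^ n ≤ n.factorial * (∏ i : Fin n, a i.succ) *
        (solutionsLE (fun i : Fin n => a i.succ) t).card := pow_le_card_solutionsLE ha' t
    _ ≤ n.factorial * (∏ i : Fin n, a i.succ) * ((solutionsEq a (t + F)).card * a 0) :=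
        Nat.mul_le_mul_left _ h1
    _ = _ := by rw [Fin.prod_univ_succ]; ring

theorem exists_forall_ge_representable (hN : 2 ≤ N) (ha : ∀ i, 0 < a i)
    (hgcd : Finset.univ.gcd a = 1) :
    ∃ F : ℕ, ∀ m ≥ F, ∃ c : Fin N → ℕ, ∑ i, a i * c i = m := by
  refine ⟨⌈(coveringRadius a + 1) * ∑ j, (a j : ℝ) * facetWidth a j⌉₊, fun m hm => ?_⟩
  obtain ⟨y, hy, hyr⟩ := exists_int_norm_sub_le (by omega) ha hgcd
    (lt_add_one (coveringRadius a)) m (p := incentre a m) (sum_mul_incentre hN ha m)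
  have h0 := nonneg_of_norm_incentre_sub_le hN ha (Nat.ceil_le.1 hm) hy hyr
  lift y to Fin N → ℕ using h0
  refine ⟨y, ?_⟩
  beta_reduce at hy
  exact_mod_cast hy

/-! ### Pigeonhole modulo multiples of the lattice -/

/-- Integer vectors with the same image under the functional `a` can be sorted into `m ^ (N - 1)`
classes modulo `m` times the lattice. -/
theorem exists_coordinates (hN : 0 < N) (hgcd : Finset.univ.gcd a = 1) :
    ∃ φ : (Fin N → ℤ) → Fin (N - 1) → ℤ, ∀ (m : ℤ) (x x' : Fin N → ℤ),
      ∑ i, (a i : ℤ) * x i = ∑ i, (a i : ℤ) * x' i → (∀ i, m ∣ φ x i - φ x' i) →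
      ∃ l : Fin N → ℤ, ∑ i, (a i : ℤ) * l i = 0 ∧ x - x' = m • l := by
  obtain ⟨u, hu⟩ := exists_int_combination hgcd 1
  set f : (Fin N → ℤ) →ₗ[ℤ] ℤ := Fintype.linearCombination ℤ (fun i => (a i : ℤ))
  have hf : ∀ x, f x = ∑ i, (a i : ℤ) * x i := fun x => by
    simp [f, Fintype.linearCombination_apply, mul_comm]
  have hsurj : LinearMap.range f = ⊤ := LinearMap.range_eq_top.2 fun z =>
    ⟨z • u, by rw [map_smul, hf, hu, smul_eq_mul, mul_one]⟩
  have hrank : Module.finrank ℤ (LinearMap.ker f) = N - 1 := by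
    have := Submodule.finrank_quotient_add_finrank (LinearMap.ker f)
    rw [f.quotKerEquivRange.finrank_eq, hsurj, finrank_top, Module.finrank_self,
      Module.finrank_fin_fun] at this
    omega
  let e : LinearMap.ker f ≃ₗ[ℤ] (Fin (N - 1) → ℤ) :=
    ((Module.finBasis ℤ (LinearMap.ker f)).reindex (finCongr hrank)).equivFun
  -- As f(u) = 1, subtracting f(x)u projects onto the kernel, where a basis supplies N - 1
  -- coordinates.
  have hmem : ∀ x, x - f x • u ∈ LinearMap.ker f := fun x => by
    rw [LinearMap.mem_ker, map_sub, map_smul, hf u, hu, smul_eq_mul, mul_one, sub_self]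
  refine ⟨fun x => e ⟨x - f x • u, hmem x⟩, fun m x x' hxx hdvd => ?_⟩
  rw [← hf, ← hf] at hxx
  choose w hw using hdvd
  have h : e (⟨x - f x • u, hmem x⟩ - ⟨x' - f x' • u, hmem x'⟩) = e (m • e.symm w) := by
    rw [map_sub, map_smul, e.apply_symm_apply]
    funext i
    simpa using hw i
  have h2 := congrArg Subtype.val (e.injective h)
  refine ⟨(e.symm w : Fin N → ℤ), by rw [← hf]; exact (e.symm w).2, ?_⟩
  simpa [hxx] using h2

/-- Pigeonhole principle: if a scaled and shrunk copy of the simplex has more than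
`s * m ^ (N - 1)` integer points, then the simplex has more than `s`. -/
theorem lt_encard_representations_of_lt_card (hN : 0 < N) (ha : ∀ i, 0 < a i)
    (hgcd : Finset.univ.gcd a = 1) {r : ℝ} (hr : coveringRadius a < r) {s t m M : ℕ} (hm : 0 < m)
    (hM : M + ∑ i, a i * ⌈m * (r * facetWidth a i)⌉₊ = m * t)
    (hs : s * m ^ (N - 1) < (solutionsEq a M).card) :
    (s : ℕ∞) < (representations a t).encard := by
  classical
  have : NeZero m := ⟨hm.ne'⟩
  have hm' : (0 : ℝ) < m := by exact_mod_cast hm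
  obtain ⟨φ, hφ⟩ := exists_coordinates hN hgcd
  obtain ⟨κ, -, hκ⟩ := Finset.exists_lt_card_fiber_of_mul_lt_card_of_maps_to
    (s := solutionsEq a M) (t := (Finset.univ : Finset (Fin (N - 1) → ZMod m))) (n := s)
    (f := fun x i => ((φ (fun j => (x j : ℤ)) i : ℤ) : ZMod m)) (fun _ _ => Finset.mem_univ _)
    (by simpa [mul_comm, ZMod.card] using hs)
  set Y := (solutionsEq a M).filter
    fun x => (fun i => ((φ (fun j => (x j : ℤ)) i : ℤ) : ZMod m)) = κ with hYdef
  obtain ⟨z, hz⟩ : Y.Nonempty := Finset.card_pos.1 (by omega)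
  have hmem : ∀ x ∈ Y, ∑ i, a i * x i = M := fun x hx =>
    (mem_solutionsEq ha).1 (Finset.mem_filter.1 hx).1
  set c : Fin N → ℕ := fun i => ⌈m * (r * facetWidth a i)⌉₊
  -- The shift `c` leaves each coordinate a margin of at least r·w_i after division by `m`, which
  -- pays for moving `p` to the integer point `y`.
  set p : EuclideanSpace ℝ (Fin N) := WithLp.toLp 2 fun i => ((z i : ℝ) + c i) / m with hpdef
  have hp : ∑ i, (a i : ℝ) * p i = t := by
    have h1 : ((∑ i, a i * z i + ∑ i, a i * c i : ℕ) : ℝ) = m * t := by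
      rw [hmem z hz, hM, Nat.cast_mul]
    have h2 : ∑ i, (a i : ℝ) * p i = ((∑ i, a i * z i + ∑ i, a i * c i : ℕ) : ℝ) / m := by
      push_cast
      rw [← Finset.sum_add_distrib, Finset.sum_div]
      exact Finset.sum_congr rfl fun i _ => by simp only [hpdef]; ring
    rw [h2, h1, mul_div_cancel_left₀ _ hm'.ne']
  obtain ⟨y, hy, hyr⟩ := exists_int_norm_sub_le hN ha hgcd hr t hp
  have hl : ∀ x ∈ Y, ∃ l : Fin N → ℤ, ∑ i, (a i : ℤ) * l i = 0 ∧
      (fun i => (x i : ℤ)) - (fun i => (z i : ℤ)) = (m : ℤ) • l := by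
    intro x hx
    refine hφ m _ _ ?_ fun i => ?_
    · have h1 := hmem x hx
      have h2 := hmem z hz
      rw [← h2] at h1
      exact_mod_cast h1
    · have h1 := congrFun (Finset.mem_filter.1 hx).2 i
      have h2 := congrFun (Finset.mem_filter.1 hz).2 i
      rw [← h2] at h1
      exact (Int.modEq_iff_dvd.1 ((ZMod.intCast_eq_intCast_iff _ _ _).1 h1.symm))
  choose! l hl0 hl using hl
  have hinj : Set.InjOn (fun x => y + l x) Y := by
    intro x hx x' hx' h
    have h1 : l x = l x' := add_left_cancel h
    have h2 := hl x hx
    rw [h1, ← hl x' hx', sub_left_inj] at h2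
    funext i
    exact_mod_cast congrFun h2 i
  refine lt_of_lt_of_le ?_ (card_le_encard_representations (Y.image fun x => y + l x) ?_)
  · rw [Finset.card_image_of_injOn hinj]
    exact_mod_cast hκ
  · intro v hv
    obtain ⟨x, hx, rfl⟩ := Finset.mem_image.1 hv
    refine ⟨by simp [mul_add, Finset.sum_add_distrib, hy, hl0 x hx], fun i => ?_⟩
    have hy' : ∑ i, (a i : ℝ) * y i = t := by exact_mod_cast hy
    have h1 : |((z i : ℝ) + c i) / m - y i| ≤ facetWidth a i * r :=
      (abs_coord_le hN ha (z := p - intVec y)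
        (by simp [mul_sub, Finset.sum_sub_distrib, hp, hy']) i).trans
        (mul_le_mul_of_nonneg_left hyr (facetWidth_nonneg i))
    have h2 : ((x i : ℝ) - z i) = m * l x i := by
      have := congrFun (hl x hx) i
      simp only [Pi.sub_apply, Pi.smul_apply, smul_eq_mul] at this
      exact_mod_cast this
    have h3 : m * (r * facetWidth a i) ≤ c i := Nat.le_ceil _
    have h4 := (abs_le.1 h1).2
    rw [sub_le_iff_le_add, div_le_iff₀ hm'] at h4
    have h5 : (0 : ℝ) ≤ (y i + l x i) * m := by
      have : (0 : ℝ) ≤ x i := Nat.cast_nonneg _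
      nlinarith
    have h6 : (0 : ℝ) ≤ y i + l x i := nonneg_of_mul_nonneg_left h5 hm'
    simp only [Pi.add_apply]
    exact_mod_cast h6

theorem eventually_mul_pow_lt {β B S : ℝ} {n : ℕ} (h : S < β ^ n) :
    ∀ᶠ m : ℕ in Filter.atTop, S * (m : ℝ) ^ n < (m * β - B) ^ n := by
  have h1 : Filter.Tendsto (fun m : ℕ => (β - B / m) ^ n) Filter.atTop (nhds (β ^ n)) := by
    have := (tendsto_const_nhds (x := β)).sub (tendsto_const_div_atTop_nhds_zero_nat B)
    rw [sub_zero] at this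
    exact this.pow n
  filter_upwards [h1.eventually_const_lt h, Filter.eventually_gt_atTop 0] with m hm h0
  have h0' : (0 : ℝ) < m := by exact_mod_cast h0
  have h2 : m * β - B = (β - B / m) * m := by field_simp
  rw [h2, mul_pow]
  exact mul_lt_mul_of_pos_right hm (by positivity)

/-- If the simplex shrunk by a radius above the covering radius has normalized volume larger than
`s`, then there are more than `s` representations. -/
theorem lt_encard_representations_of_lt_volume (hN : 2 ≤ N) (ha : ∀ i, 0 < a i)
    (hgcd : Finset.univ.gcd a = 1) {r : ℝ} (hr : coveringRadius a < r) {s t : ℕ}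
    (hrt : r * ∑ i, (a i : ℝ) * facetWidth a i < t)
    (hs : (s : ℝ) * ((N - 1).factorial * ∏ i, (a i : ℝ)) <
      (t - r * ∑ i, (a i : ℝ) * facetWidth a i) ^ (N - 1)) :
    (s : ℕ∞) < (representations a t).encard := by
  obtain ⟨n, rfl⟩ : ∃ n, N = n + 1 := ⟨N - 1, by omega⟩
  obtain ⟨F, hF⟩ := exists_forall_ge_representable hN ha hgcd
  set W := ∑ i, (a i : ℝ) * facetWidth a i
  -- `B` bounds the total loss from the ceilings and from the shift by `F`; it does not grow with
  -- `m`.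
  set B : ℝ := ∑ i, (a i : ℝ) + F
  have hr0 : 0 ≤ r := coveringRadius_nonneg.trans hr.le
  have hβ : 0 < t - r * W := sub_pos.2 hrt
  obtain ⟨m, hm, hm0, hmB⟩ := ((eventually_mul_pow_lt (B := B) hs).and
    ((Filter.eventually_gt_atTop 0).and
      ((tendsto_natCast_atTop_atTop.atTop_mul_const hβ).eventually_ge_atTop B))).exists
  simp only [Nat.add_sub_cancel] at hm
  set K : ℕ := ∑ i, a i * ⌈m * (r * facetWidth a i)⌉₊
  have hK : (K : ℝ) ≤ m * (r * W) + ∑ i, (a i : ℝ) := by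
    simp only [K, W, Nat.cast_sum, Nat.cast_mul, Finset.mul_sum]
    rw [← Finset.sum_add_distrib]
    refine Finset.sum_le_sum fun i _ => ?_
    have h1 : (⌈m * (r * facetWidth a i)⌉₊ : ℝ) ≤ m * (r * facetWidth a i) + 1 :=
      (Nat.ceil_lt_add_one (mul_nonneg (Nat.cast_nonneg _)
        (mul_nonneg hr0 (facetWidth_nonneg i)))).le
    refine (mul_le_mul_of_nonneg_left h1 (Nat.cast_nonneg (a i))).trans (le_of_eq ?_)
    ring
  have hKF : K + F ≤ m * t := by
    have : (K : ℝ) + F ≤ m * t := by linarith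
    exact_mod_cast this
  obtain ⟨T, hT⟩ := Nat.exists_eq_add_of_le' hKF
  refine lt_encard_representations_of_lt_card (by omega) ha hgcd hr (M := T + F) hm0
    (by rw [hT]; ring) ?_
  have h1 : (T ^ n : ℝ) ≤ n.factorial * (∏ i, (a i : ℝ)) * (solutionsEq a (T + F)).card := by
    exact_mod_cast pow_le_card_solutionsEq ha hF T
  have h2 : m * (t - r * W) - B ≤ T := by
    have : (m : ℝ) * t = T + (K + F) := by exact_mod_cast hT
    linarith
  have h3 := hm.trans_le ((pow_le_pow_left₀ (by linarith) h2 n).trans h1)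
  have hD : (0 : ℝ) < n.factorial * ∏ i, (a i : ℝ) :=
    mul_pos (by positivity) (Finset.prod_pos fun i _ => by exact_mod_cast ha i)
  have h4 : (s : ℝ) * m ^ n < (solutionsEq a (T + F)).card := by
    refine lt_of_mul_lt_mul_left (lt_of_eq_of_lt ?_ h3) hD.le
    ring
  exact_mod_cast h4

/-- The bound on `g_s(a)` by volume. -/
theorem lt_encard_representations_of_max_lt (hN : 3 ≤ N) (ha : ∀ i, 0 < a i)
    (hgcd : Finset.univ.gcd a = 1) {s t : ℕ}
    (ht : coveringRadius a * (N - 1) * (∑ i, (a i : ℝ) * facetWidth a i) + 1 < t)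
    (hs : ((s : ℝ) * (N - 1).factorial * ∏ i, (a i : ℝ)) ^ (1 / ((N : ℝ) - 2)) < t) :
    (s : ℕ∞) < (representations a t).encard := by
  obtain ⟨k, rfl⟩ : ∃ k, N = k + 3 := ⟨N - 3, by omega⟩
  set W := ∑ i, (a i : ℝ) * facetWidth a i
  have hW : 0 < W := sum_mul_facetWidth_pos (by omega) ha
  have hN1 : ((k + 3 : ℕ) : ℝ) - 1 = (k + 2 : ℕ) := by push_cast; ring
  have hN2 : ((k + 3 : ℕ) : ℝ) - 2 = (k + 1 : ℕ) := by push_cast; ring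
  rw [hN1] at ht
  rw [hN2] at hs
  have hn : (1 : ℝ) ≤ (k + 2 : ℕ) := by exact_mod_cast (by omega : 1 ≤ k + 2)
  have hRW : coveringRadius a < (t - 1) / ((k + 2 : ℕ) * W) := by
    rw [lt_div_iff₀ (by positivity)]
    linarith
  obtain ⟨r, hr, hrt⟩ := exists_between hRW
  rw [lt_div_iff₀ (by positivity)] at hrt
  have hr0 : 0 ≤ r := coveringRadius_nonneg.trans hr.le
  have hrW : 0 ≤ r * W := mul_nonneg hr0 hW.le
  have hle : r * W ≤ (k + 2 : ℕ) * (r * W) := le_mul_of_one_le_left hrW hn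
  have ht0 : (0 : ℝ) < t := by linarith
  refine lt_encard_representations_of_lt_volume (by omega) ha hgcd hr
    (show r * W < t by linarith) ?_
  have hpow : (s : ℝ) * (k + 3 - 1).factorial * ∏ i, (a i : ℝ) < (t : ℝ) ^ (k + 1) := by
    have hD : 0 ≤ (s : ℝ) * (k + 3 - 1).factorial * ∏ i, (a i : ℝ) :=
      mul_nonneg (by positivity) (Finset.prod_nonneg fun i _ => Nat.cast_nonneg _)
    have := pow_lt_pow_left₀ hs (Real.rpow_nonneg hD _) (Nat.succ_ne_zero k)
    rwa [one_div, Real.rpow_inv_natCast_pow hD (Nat.succ_ne_zero k)] at this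
  rw [← mul_assoc]
  refine hpow.trans ?_
  -- With n = N - 1, Bernoulli gives (t - rW)^n ≥ t^(n-1)(t - nrW), and the last factor exceeds 1 by
  -- the choice of `r`.
  have hbern := one_add_mul_le_pow (a := -(r * W / t)) (by
    have : r * W / t ≤ 1 := (div_le_one ht0).2 (by linarith)
    linarith) (k + 2)
  have h1 : (t - r * W) ^ (k + 2) = (t : ℝ) ^ (k + 2) * (1 + -(r * W / t)) ^ (k + 2) := by
    rw [← mul_pow]
    congr 1
    field_simp
    ring
  show _ < (t - r * W) ^ (k + 2)
  calc (t : ℝ) ^ (k + 1) < (t : ℝ) ^ (k + 1) * (t - (k + 2 : ℕ) * (r * W)) :=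
        lt_mul_of_one_lt_right (by positivity) (by linarith)
    _ = (t : ℝ) ^ (k + 2) * (1 + (k + 2 : ℕ) * -(r * W / t)) := by
        field_simp
        ring
    _ ≤ _ := by
        rw [h1]
        exact mul_le_mul_of_nonneg_left hbern (by positivity)

end FrobeniusBound

/-! ### The two bounds -/

theorem theorem2p1 {N : ℕ} (hN : 2 ≤ N) (a : Fin N → ℕ) (ha : ∀ i, 0 < a i)
    (hgcd : Finset.univ.gcd a = 1) (s g : ℕ) (hg : FrobeniusBound.IsSFrobeniusNumber a s g) :
    (3 ≤ N →
      (g : ℝ) ≤ max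
        (FrobeniusBound.coveringRadius a * ((N : ℝ) - 1) *
            (∑ i, FrobeniusBound.omitNorm a i * (a i : ℝ)) / FrobeniusBound.vecNorm a + 1)
        (((s : ℝ) * ((N - 1).factorial : ℝ) * ∏ i, (a i : ℝ)) ^ (1 / ((N : ℝ) - 2)))) ∧
    ((s : ℕ∞) ≤ FrobeniusBound.kissingNumber (N - 1) + 1 → ¬ (N = 2 ∧ s = 3) →
      (g : ℝ) ≤ 3 * FrobeniusBound.coveringRadius a *
        (∑ i, FrobeniusBound.omitNorm a i * (a i : ℝ)) / FrobeniusBound.vecNorm a) := by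
  have hcard := hg.1.2
  rw [mul_div_assoc, mul_div_assoc, ← FrobeniusBound.sum_mul_facetWidth]
  refine ⟨fun hN3 => ?_, fun hs hNs => ?_⟩
  · by_contra! h
    obtain ⟨h1, h2⟩ := max_lt_iff.1 h
    exact (FrobeniusBound.lt_encard_representations_of_max_lt hN3 ha hgcd h1 h2).ne' hcard
  · by_contra! h
    exact (FrobeniusBound.lt_encard_representations_of_le_kissingNumber hN ha hgcd hs hNs h).ne'
      hcard
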